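/- For probability measures $\nu_0,\nu_1$ on $\mathbb{R}^d$ (with the Euclidean norm) let $\mathrm{W}_2(\nu_0,\nu_1) = \left(\inf_{\gamma}\int \|x-y\|^2\,d\gamma(x,y)\right)^{1/2}$, the infimum being over all probability measures $\gamma$ on $\mathbb{R}^d\times\mathbb{R}^d$ with marginals $\nu_0$ and $\nu_1$. Let $\mathcal{N}(\mu,C)$ denote the Gaussian measure with mean $\mu\in\mathbb{R}^d$ and (possibly singular) positive semidefinite covariance matrix $C$, and put $$\kappa = \left(2\|C\|_{\mathrm{HS}}^2 + 4\langle\mu, C\mu\rangle + (\mathrm{Tr}\,C + \|\mu\|^2)^2\right)^{1/4},$$ where $\|\cdot\|_{\mathrm{HS}}$ is the Hilbert--Schmidt (Frobenius) norm. For $m\ge 1$ let $\mathbf{X} = (x_i)_{i=1}^m$ be independent samples from $\mathcal{N}(\mu,C)$, with empirical mean and covariance $$\mu_{\mathbf{X}} = \frac1m\sum_{i=1}^m x_i,\qquad C_{\mathbf{X}} = \frac1m\sum_{i=1}^m (x_i-\mu_{\mathbf{X}})(x_i-\mu_{\mathbf{X}})^T.$$ Then for every $0<\delta<1$ there is a constant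 $K>0$ depending only on $\delta$ such that, for all $d$, all $m\ge1$ and all $\mu$, $C$ as above, with probability at least $1-\delta$ both $$\mathrm{W}_2^2[\mathcal{N}(\mu_{\mathbf{X}},C_{\mathbf{X}}),\mathcal{N}(\mu,C)] \le \frac{4\kappa^2}{m\delta^2} + \frac{2\kappa^2\sqrt d}{\sqrt m\,\delta}\left(3+\frac{2}{\sqrt m\,\delta}\right)$$ and $$\mathrm{W}_2[\mathcal{N}(\mu_{\mathbf{X}},C_{\mathbf{X}}),\mathcal{N}(\mu,C)] \le K\,\kappa\left(\frac dm\right)^{1/4}.$$ In other words, for fixed $\kappa$ and $\delta$ the convergence rate in $\mathrm{W}_2$ is $O((d/m)^{1/4})$. -/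

import Mathlib

open MeasureTheory ProbabilityTheory
open scoped ENNReal

/-- `Joint(ν₀, ν₁)`: the joint probability measures on `X × X` with marginals `ν₀` and `ν₁`. -/
def Joint {X : Type*} [MeasurableSpace X] (ν₀ ν₁ : Measure X) : Set (Measure (X × X)) :=
  {γ | IsProbabilityMeasure γ ∧ γ.map Prod.fst = ν₀ ∧ γ.map Prod.snd = ν₁}

/-- The optimal transport cost `inf_{γ ∈ Joint(ν₀, ν₁)} ∫ c(x, y) dγ(x, y)`, in `[0, ∞]`. -/
noncomputable def OT {X : Type*} [MeasurableSpace X] (c : X → X → ℝ≥0∞) (ν₀ ν₁ : Measure X) :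
    ℝ≥0∞ :=
  ⨅ γ ∈ Joint ν₀ ν₁, ∫⁻ z, c z.1 z.2 ∂γ

/-- The `p`-Wasserstein distance `OT_{d^p}(ν₀, ν₁)^{1/p}`, in `[0, ∞]`. -/
noncomputable def wasserstein {X : Type*} [MeasurableSpace X] [EDist X] (p : ℝ)
    (ν₀ ν₁ : Measure X) : ℝ≥0∞ :=
  OT (fun x y => edist x y ^ p) ν₀ ν₁ ^ (1 / p)

/-- The empirical mean `(1/m) ∑ᵢ xᵢ`. -/
noncomputable def empiricalMean {d m : ℕ} (x : Fin m → EuclideanSpace ℝ (Fin d)) :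
    EuclideanSpace ℝ (Fin d) :=
  (1 / (m : ℝ)) • ∑ i, x i

/-- The empirical covariance matrix `(1/m) ∑ᵢ (xᵢ - μ_x) (xᵢ - μ_x)ᵀ`. -/
noncomputable def empiricalCov {d m : ℕ} (x : Fin m → EuclideanSpace ℝ (Fin d)) :
    Matrix (Fin d) (Fin d) ℝ :=
  (1 / (m : ℝ)) • ∑ i, Matrix.vecMulVec (x i - empiricalMean x).ofLp (x i - empiricalMean x).ofLp

/-- The empirical covariance matrix is positive semidefinite, so that
`multivariateGaussian (empiricalMean x) (empiricalCov x)` is a genuine Gaussian measure with that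
mean and that covariance. -/
theorem empiricalCov_posSemidef {d m : ℕ} (x : Fin m → EuclideanSpace ℝ (Fin d)) :
    (empiricalCov x).PosSemidef := by
  unfold empiricalCov
  refine Matrix.PosSemidef.smul (Matrix.posSemidef_sum _ fun i _ => ?_) (by positivity)
  simpa using Matrix.posSemidef_vecMulVec_self_star (x i - empiricalMean x).ofLp

section HilbertSchmidt

attribute [local instance] Matrix.frobeniusNormedAddCommGroup

/-- The Hilbert–Schmidt (Frobenius) norm of a real square matrix. -/
noncomputable def hsNorm {d : ℕ} (A : Matrix (Fin d) (Fin d) ℝ) : ℝ := ‖A‖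

end HilbertSchmidt

/-- `κ = (2 ‖C‖²_HS + 4 ⟨μ, C μ⟩ + (Tr C + ‖μ‖²)²)^{1/4}`. -/
noncomputable def gaussianKappa {d : ℕ} (μ : EuclideanSpace ℝ (Fin d))
    (C : Matrix (Fin d) (Fin d) ℝ) : ℝ :=
  (2 * hsNorm C ^ 2 + 4 * inner ℝ μ (Matrix.toEuclideanCLM (𝕜 := ℝ) C μ)
    + (C.trace + ‖μ‖ ^ 2) ^ 2) ^ ((1 : ℝ) / 4)

/-! Driving both Gaussians by one standard Gaussian bounds the squared distance by `‖μ_X - μ‖² +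
‖√C_X - √C‖²` in Hilbert–Schmidt norm (`wasserstein_two_sq_multivariateGaussian_le`). The
Powers–Størmer inequality replaces the second term by `√d ‖C_X - C‖`, which is where the dimension
enters.

Up to the rank-one matrix of `μ_X - μ`, `C_X` is an average of independent matrices with mean `C`.
Gaussian second and fourth moments bound the mean square errors by `Tr C / m` and `3 (Tr C)² / m`,
and Markov's inequality at level `δ/2` for each gives the good event
(`exists_measurableSet_empirical_close`). Since `Tr C ≤ κ²`, the rest is arithmetic. -/

/-! ### Hilbert–Schmidt norm and the Powers–Størmer inequality. -/

/-- The squared Hilbert–Schmidt norm is the sum of the squared entries. -/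
theorem hsNorm_sq {d : ℕ} (A : Matrix (Fin d) (Fin d) ℝ) :
    hsNorm A ^ 2 = ∑ i, ∑ j, A i j ^ 2 := by
  rw [hsNorm, Matrix.frobenius_norm_def, ← Real.sqrt_eq_rpow, Real.sq_sqrt (by positivity)]
  simp

theorem hsNorm_nonneg {d : ℕ} (A : Matrix (Fin d) (Fin d) ℝ) : 0 ≤ hsNorm A := by
  rw [hsNorm, Matrix.frobenius_norm_def]; positivity

section
attribute [local instance] Matrix.frobeniusNormedAddCommGroup

theorem hsNorm_sub_le {d : ℕ} (A B : Matrix (Fin d) (Fin d) ℝ) :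
    hsNorm (A - B) ≤ hsNorm A + hsNorm B := norm_sub_le A B

end

theorem hsNorm_sq_eq_trace {d : ℕ} (A : Matrix (Fin d) (Fin d) ℝ) :
    hsNorm A ^ 2 = (A.transpose * A).trace := by
  rw [hsNorm_sq, Matrix.trace, Finset.sum_comm]
  simp [Matrix.mul_apply, sq]

theorem hsNorm_conj_unitary {d : ℕ} (U : Matrix.unitaryGroup (Fin d) ℝ)
    (A : Matrix (Fin d) (Fin d) ℝ) :
    hsNorm ((U : Matrix (Fin d) (Fin d) ℝ).transpose * A * (U : Matrix (Fin d) (Fin d) ℝ)) = hsNorm A := by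
  have hU : (U : Matrix (Fin d) (Fin d) ℝ) * (U : Matrix (Fin d) (Fin d) ℝ).transpose = 1 := by
    have := Matrix.mem_unitaryGroup_iff.1 U.2
    simpa [Matrix.star_eq_conjTranspose, Matrix.conjTranspose_eq_transpose_of_trivial] using this
  refine (sq_eq_sq₀ (hsNorm_nonneg _) (hsNorm_nonneg _)).1 ?_
  rw [hsNorm_sq_eq_trace, hsNorm_sq_eq_trace]
  set V := (U : Matrix (Fin d) (Fin d) ℝ)
  have : (V.transpose * A * V).transpose * (V.transpose * A * V)
      = V.transpose * (A.transpose * A * V) := by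
    simp only [Matrix.transpose_mul, Matrix.transpose_transpose, Matrix.mul_assoc]
    rw [← Matrix.mul_assoc V V.transpose, hU, Matrix.one_mul]
  rw [this, Matrix.trace_mul_comm, Matrix.mul_assoc, hU, Matrix.mul_one]

/-- The diagonal of `S² - R²` is `l i * (S i i + R i i)`, and `|l i| ≤ S i i + R i i` because both
diagonals are nonnegative. Hence `l i ^ 2` is at most the absolute diagonal entry, and
Cauchy–Schwarz over the `d` entries costs `√d`. -/
theorem powersStormer_of_sub_eq_diagonal {d : ℕ} {S R : Matrix (Fin d) (Fin d) ℝ}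
    (hS : S.PosSemidef) (hR : R.PosSemidef) {l : Fin d → ℝ}
    (h : S - R = Matrix.diagonal l) :
    hsNorm (S - R) ^ 2 ≤ √(d : ℝ) * hsNorm (S * S - R * R) := by
  have hSR : S = R + Matrix.diagonal l := by rw [← h]; abel
  have hdiag (i : Fin d) : (S * S - R * R) i i = l i * (S i i + R i i) := by
    subst hSR
    simp [add_mul, mul_add, Matrix.add_apply]
    ring
  have hl (i : Fin d) : S i i - R i i = l i := by
    simpa using congrFun (congrFun h i) i
  have hS0 (i : Fin d) : 0 ≤ S i i := hS.diag_nonneg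
  have hR0 (i : Fin d) : 0 ≤ R i i := hR.diag_nonneg
  have h1 : hsNorm (S - R) ^ 2 = ∑ i, l i ^ 2 := by
    rw [h, hsNorm_sq]
    refine Finset.sum_congr rfl fun i _ => ?_
    rw [Finset.sum_eq_single i] <;> simp +contextual [eq_comm]
  have h2 : ∑ i, l i ^ 2 ≤ ∑ i, |(S * S - R * R) i i| := by
    refine Finset.sum_le_sum fun i _ => ?_
    rw [hdiag, abs_mul, abs_of_nonneg (add_nonneg (hS0 i) (hR0 i)), ← sq_abs, sq]
    refine mul_le_mul_of_nonneg_left ?_ (abs_nonneg _)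
    rw [← hl, abs_le]
    constructor <;> linarith [hS0 i, hR0 i]
  have h3 : (∑ i, |(S * S - R * R) i i|) ^ 2 ≤ d * hsNorm (S * S - R * R) ^ 2 := by
    have := sq_sum_le_card_mul_sum_sq (s := Finset.univ)
      (f := fun i => |(S * S - R * R) i i|)
    simp only [Finset.card_univ, Fintype.card_fin, sq_abs] at this
    refine this.trans (mul_le_mul_of_nonneg_left ?_ (by positivity))
    rw [hsNorm_sq]
    exact Finset.sum_le_sum fun i _ =>
      Finset.single_le_sum (f := fun j => (S * S - R * R) i j ^ 2)
        (fun j _ => sq_nonneg _) (Finset.mem_univ i)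
  rw [h1]
  refine h2.trans (abs_le_of_sq_le_sq' ?_ ?_).2
  · rwa [mul_pow, Real.sq_sqrt (by positivity)]
  · exact mul_nonneg (Real.sqrt_nonneg _) (hsNorm_nonneg _)

/-- A Powers–Størmer inequality in the Hilbert–Schmidt norm. -/
theorem powersStormer {d : ℕ} {S R : Matrix (Fin d) (Fin d) ℝ}
    (hS : S.PosSemidef) (hR : R.PosSemidef) :
    hsNorm (S - R) ^ 2 ≤ √(d : ℝ) * hsNorm (S * S - R * R) := by
  -- An eigenbasis of the difference `S - R` reduces to the diagonal case: conjugation preserves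
  -- positivity, squares and the norm.
  have hD : (S - R).IsHermitian := hS.1.sub hR.1
  set U := hD.eigenvectorUnitary
  set V := (U : Matrix (Fin d) (Fin d) ℝ) with hV
  have hU : V * V.transpose = 1 := by
    have := Matrix.mem_unitaryGroup_iff.1 U.2
    simpa [Matrix.star_eq_conjTranspose, Matrix.conjTranspose_eq_transpose_of_trivial] using this
  have hsq (A : Matrix (Fin d) (Fin d) ℝ) :
      (V.transpose * A * V) * (V.transpose * A * V) = V.transpose * (A * A) * V := by
    simp only [Matrix.mul_assoc]
    rw [← Matrix.mul_assoc V V.transpose, hU, Matrix.one_mul]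
  have hpos {A : Matrix (Fin d) (Fin d) ℝ} (hA : A.PosSemidef) :
      (V.transpose * A * V).PosSemidef := by
    have := hA.conjTranspose_mul_mul_same V
    rwa [Matrix.conjTranspose_eq_transpose_of_trivial] at this
  have hd : V.transpose * S * V - V.transpose * R * V = Matrix.diagonal hD.eigenvalues := by
    rw [← Matrix.sub_mul, ← Matrix.mul_sub]
    have := hD.conjStarAlgAut_star_eigenvectorUnitary
    rw [Unitary.conjStarAlgAut_apply] at this
    simpa [Matrix.star_eq_conjTranspose, Matrix.conjTranspose_eq_transpose_of_trivial] using this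
  have := powersStormer_of_sub_eq_diagonal (hpos hS) (hpos hR) hd
  rwa [hsq, hsq, ← Matrix.sub_mul, ← Matrix.mul_sub, ← Matrix.sub_mul, ← Matrix.mul_sub,
    hsNorm_conj_unitary, hsNorm_conj_unitary] at this

open scoped MatrixOrder in
theorem hsNorm_sqrt_sub_sqrt_sq_le {d : ℕ} {A B : Matrix (Fin d) (Fin d) ℝ}
    (hA : A.PosSemidef) (hB : B.PosSemidef) :
    hsNorm (CFC.sqrt A - CFC.sqrt B) ^ 2 ≤ √(d : ℝ) * hsNorm (A - B) := by
  have := powersStormer (Matrix.nonneg_iff_posSemidef.1 (CFC.sqrt_nonneg A))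
    (Matrix.nonneg_iff_posSemidef.1 (CFC.sqrt_nonneg B))
  rwa [CFC.sqrt_mul_sqrt_self _ hA.nonneg, CFC.sqrt_mul_sqrt_self _ hB.nonneg] at this

/-! ### Second moments of affine images of the standard Gaussian. -/

theorem memLp_inner_stdGaussian {E : Type*} [NormedAddCommGroup E]
    [InnerProductSpace ℝ E] [FiniteDimensional ℝ E] [MeasurableSpace E] [BorelSpace E]
    (v : E) :
    MemLp (fun x : E => inner ℝ v x) 2 (stdGaussian E) :=
  (innerSL ℝ v).comp_memLp' IsGaussian.memLp_two_id

theorem integral_inner_stdGaussian {E : Type*} [NormedAddCommGroup E]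
    [InnerProductSpace ℝ E] [FiniteDimensional ℝ E] [MeasurableSpace E] [BorelSpace E]
    (v : E) :
    ∫ x, inner ℝ v x ∂stdGaussian E = 0 :=
  integral_strongDual_stdGaussian (innerSL ℝ v)

theorem variance_inner_stdGaussian {E : Type*} [NormedAddCommGroup E]
    [InnerProductSpace ℝ E] [FiniteDimensional ℝ E] [MeasurableSpace E] [BorelSpace E]
    (v : E) :
    Var[fun x => inner ℝ v x; stdGaussian E] = ‖v‖ ^ 2 := by
  have := variance_dual_stdGaussian (innerSL ℝ v)
  rwa [innerSL_apply_norm] at this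

theorem memLp_const_add_inner_stdGaussian {E : Type*} [NormedAddCommGroup E]
    [InnerProductSpace ℝ E] [FiniteDimensional ℝ E] [MeasurableSpace E] [BorelSpace E]
    (c : ℝ) (v : E) :
    MemLp (fun x : E => c + inner ℝ v x) 2 (stdGaussian E) :=
  (memLp_const c).add (memLp_inner_stdGaussian v)

/-- The second moment of an affine functional under the standard Gaussian measure. -/
theorem integral_const_add_inner_sq_stdGaussian {E : Type*} [NormedAddCommGroup E]
    [InnerProductSpace ℝ E] [FiniteDimensional ℝ E] [MeasurableSpace E] [BorelSpace E]
    (c : ℝ) (v : E) :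
    ∫ x, (c + inner ℝ v x) ^ 2 ∂stdGaussian E = c ^ 2 + ‖v‖ ^ 2 := by
  have h := variance_eq_sub (memLp_const_add_inner_stdGaussian c v)
  rw [variance_const_add (memLp_inner_stdGaussian v).aestronglyMeasurable,
    variance_inner_stdGaussian, integral_add (integrable_const _)
      ((memLp_inner_stdGaussian v).integrable one_le_two), integral_inner_stdGaussian] at h
  simp only [Pi.pow_apply, integral_const, probReal_univ, smul_eq_mul, one_mul, add_zero] at h
  linarith

/-- The cost of the coupling of two Gaussian measures that is driven by one standard Gaussian. -/
theorem integral_norm_add_toEuclideanCLM_sq {d : ℕ} (a : EuclideanSpace ℝ (Fin d))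
    (D : Matrix (Fin d) (Fin d) ℝ) :
    Integrable (fun x => ‖a + Matrix.toEuclideanCLM (𝕜 := ℝ) D x‖ ^ 2)
      (stdGaussian (EuclideanSpace ℝ (Fin d))) ∧
    ∫ x, ‖a + Matrix.toEuclideanCLM (𝕜 := ℝ) D x‖ ^ 2 ∂stdGaussian (EuclideanSpace ℝ (Fin d))
      = ‖a‖ ^ 2 + ∑ i, ∑ j, D i j ^ 2 := by
  have hexp : (fun x => ‖a + Matrix.toEuclideanCLM (𝕜 := ℝ) D x‖ ^ 2)
      = fun x => ∑ i, (a i + inner ℝ (WithLp.toLp 2 (D i)) x) ^ 2 := by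
    ext x
    simp [EuclideanSpace.norm_sq_eq, PiLp.inner_apply, Matrix.mulVec, dotProduct, mul_comm]
  have h (i : Fin d) :=
    (memLp_const_add_inner_stdGaussian (a i) (WithLp.toLp 2 (D i))).integrable_sq
  rw [hexp]
  refine ⟨integrable_finsetSum _ fun i _ => h i, ?_⟩
  rw [integral_finsetSum _ fun i _ => h i, EuclideanSpace.norm_sq_eq, ← Finset.sum_add_distrib]
  refine Finset.sum_congr rfl fun i _ => ?_
  rw [integral_const_add_inner_sq_stdGaussian, EuclideanSpace.norm_sq_eq]
  simp

/-! ### Real Gaussian moments, Markov's inequality, averages. -/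

theorem integral_gaussianReal_zero_pow_two (v : NNReal) : ∫ x, x ^ 2 ∂gaussianReal 0 v = v := by
  have := variance_of_integral_eq_zero (μ := gaussianReal 0 v) (X := id) aemeasurable_id
    (by simp)
  simpa using this.symm

/-- The fourth moment is the fourth derivative at `0` of the moment generating function `exp (v t² /
2)`. -/
theorem integral_gaussianReal_zero_pow_four (v : NNReal) :
    ∫ x, x ^ 4 ∂gaussianReal 0 v = 3 * (v : ℝ) ^ 2 := by
  have h0 : (0 : ℝ) ∈ interior (integrableExpSet id (gaussianReal 0 v)) := by simp
  have h := iteratedDeriv_mgf_zero h0 4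
  simp only [Pi.pow_apply, id_eq] at h
  have hE (t : ℝ) : HasDerivAt (fun t : ℝ => Real.exp ((v : ℝ) * t ^ 2 / 2))
      (Real.exp ((v : ℝ) * t ^ 2 / 2) * (v * t)) t := by
    refine HasDerivAt.exp ?_
    convert! ((hasDerivAt_pow 2 t).const_mul (v : ℝ)).div_const 2 using 1
    simp; ring
  have h1 : deriv (fun t : ℝ => Real.exp ((v : ℝ) * t ^ 2 / 2))
      = fun t => Real.exp ((v : ℝ) * t ^ 2 / 2) * (v * t) := funext fun t => (hE t).deriv
  have h2 : deriv (fun t : ℝ => Real.exp ((v : ℝ) * t ^ 2 / 2) * (v * t))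
      = fun t => Real.exp ((v : ℝ) * t ^ 2 / 2) * (v + v ^ 2 * t ^ 2) := by
    funext t
    refine HasDerivAt.deriv ?_
    convert! (hE t).mul ((hasDerivAt_id t).const_mul (v : ℝ)) using 1
    simp; ring
  have h3 : deriv (fun t : ℝ => Real.exp ((v : ℝ) * t ^ 2 / 2) * (v + v ^ 2 * t ^ 2))
      = fun t => Real.exp ((v : ℝ) * t ^ 2 / 2) * (3 * v ^ 2 * t + v ^ 3 * t ^ 3) := by
    funext t
    refine HasDerivAt.deriv ?_
    convert! (hE t).mul (((hasDerivAt_pow 2 t).const_mul ((v : ℝ) ^ 2)).const_add (v : ℝ)) using 1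
    simp; ring
  have h4 : deriv (fun t : ℝ => Real.exp ((v : ℝ) * t ^ 2 / 2) * (3 * v ^ 2 * t + v ^ 3 * t ^ 3)) 0
      = 3 * (v : ℝ) ^ 2 := by
    refine HasDerivAt.deriv ?_
    convert! (hE 0).mul (((hasDerivAt_id (0 : ℝ)).const_mul (3 * (v : ℝ) ^ 2)).add
      ((hasDerivAt_pow 3 (0 : ℝ)).const_mul ((v : ℝ) ^ 3))) using 1
    simp
  rw [← h, mgf_id_gaussianReal]
  simp only [iteratedDeriv_succ, iteratedDeriv_zero, zero_mul, zero_add, h1, h2, h3, h4]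

/-- Markov's inequality, with a strict excess so that the bound `a = 0` is allowed. -/
theorem meas_div_lt_le {Ω : Type*} [MeasurableSpace Ω] {P : Measure Ω} [IsFiniteMeasure P]
    {f : Ω → ℝ} (hf : Integrable f P) (h0 : ∀ ω, 0 ≤ f ω) {a ε : ℝ} (hε : 0 < ε)
    (ha : ∫ ω, f ω ∂P ≤ a) : P {ω | a / ε < f ω} ≤ ENNReal.ofReal ε := by
  have ha0 : 0 ≤ a := (integral_nonneg h0).trans ha
  -- For `a = 0`, which occurs when `C = 0`, the usual inequality says nothing, but then `f`
  -- vanishes almost everywhere.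
  rcases ha0.eq_or_lt with rfl | hpos
  · have hz : f =ᵐ[P] 0 :=
      (integral_eq_zero_iff_of_nonneg h0 hf).1 (le_antisymm ha (integral_nonneg h0))
    have : P {ω | 0 / ε < f ω} = 0 := by
      refine measure_mono_null (fun ω hω => ?_) (ae_iff.1 hz)
      simp only [Set.mem_ofPred_eq, zero_div] at hω ⊢
      exact hω.ne'
    rw [this]
    exact zero_le
  · have hm := mul_meas_ge_le_integral_of_nonneg (Filter.Eventually.of_forall h0) hf (a / ε)
    have hm' : P.real {ω | a / ε ≤ f ω} ≤ ε := by
      have := hm.trans ha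
      rw [div_mul_eq_mul_div, div_le_iff₀ hε] at this
      exact le_of_mul_le_mul_left this hpos
    refine (measure_mono fun ω hω => ?_).trans
      (ENNReal.le_ofReal_iff_toReal_le (measure_ne_top P _) hε.le |>.2 hm')
    exact (show a / ε < f ω from hω).le

/-- The mean square error of an average of independent variables. -/
theorem integral_average_sub_sq_le {Ω : Type*} [MeasurableSpace Ω] {P : Measure Ω}
    [IsProbabilityMeasure P] {m : ℕ} (hm : 0 < m) {Z : Fin m → Ω → ℝ}
    (hZ : ∀ i, MemLp (Z i) 2 P) (hind : iIndepFun Z P) {c v : ℝ}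
    (hc : ∀ i, ∫ ω, Z i ω ∂P = c) (hv : ∀ i, ∫ ω, Z i ω ^ 2 ∂P ≤ v) :
    Integrable (fun ω => ((1 / (m : ℝ)) * ∑ i, Z i ω - c) ^ 2) P ∧
    ∫ ω, ((1 / (m : ℝ)) * ∑ i, Z i ω - c) ^ 2 ∂P ≤ v / m := by
  have hm0 : (m : ℝ) ≠ 0 := by positivity
  have hS : MemLp (fun ω => ∑ i, Z i ω) 2 P := memLp_finsetSum _ fun i _ => hZ i
  have hA : MemLp (fun ω => (1 / (m : ℝ)) * ∑ i, Z i ω) 2 P := hS.const_mul _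
  have hmean : ∫ ω, (1 / (m : ℝ)) * ∑ i, Z i ω ∂P = c := by
    rw [integral_const_mul, integral_finsetSum _ fun i _ => (hZ i).integrable one_le_two]
    simp [hc, hm0]
  refine ⟨(hA.sub (memLp_const c)).integrable_sq, ?_⟩
  have h1 : Var[fun ω => (1 / (m : ℝ)) * ∑ i, Z i ω; P]
      = ∫ ω, ((1 / (m : ℝ)) * ∑ i, Z i ω - c) ^ 2 ∂P := by
    rw [variance_eq_integral hA.aestronglyMeasurable.aemeasurable, hmean]
  have h2 : Var[fun ω => ∑ i, Z i ω; P] = ∑ i, Var[Z i; P] := by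
    have := IndepFun.variance_sum (s := Finset.univ) (fun i _ => hZ i)
      (fun i _ j _ hij => hind.indepFun hij)
    rw [← this]
    congr 1
    ext ω
    simp
  rw [← h1, variance_const_mul, h2]
  have h3 : ∑ i, Var[Z i; P] ≤ m * v := by
    have : ∑ i, Var[Z i; P] ≤ ∑ _i : Fin m, v :=
      Finset.sum_le_sum fun i _ =>
        (variance_le_expectation_sq (hZ i).aestronglyMeasurable).trans (hv i)
    simpa using this
  calc (1 / (m : ℝ)) ^ 2 * ∑ i, Var[Z i; P] ≤ (1 / (m : ℝ)) ^ 2 * (m * v) := by gcongr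
    _ = v / m := by field_simp

/-! ### Wasserstein distance between two Gaussians. -/

theorem wasserstein_two_sq {X : Type*} [MeasurableSpace X] [EDist X] (ν₀ ν₁ : Measure X) :
    wasserstein 2 ν₀ ν₁ ^ 2 = OT (fun x y => edist x y ^ (2 : ℝ)) ν₀ ν₁ := by
  rw [wasserstein, ← ENNReal.rpow_natCast, ← ENNReal.rpow_mul]
  norm_num

open scoped MatrixOrder in
theorem wasserstein_two_sq_multivariateGaussian_le {d : ℕ} (a b : EuclideanSpace ℝ (Fin d))
    {A B : Matrix (Fin d) (Fin d) ℝ} (hA : A.PosSemidef) (hB : B.PosSemidef) :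
    wasserstein 2 (multivariateGaussian a A) (multivariateGaussian b B) ^ 2
      ≤ ENNReal.ofReal (‖a - b‖ ^ 2 + √(d : ℝ) * hsNorm (A - B)) := by
  let f (c : EuclideanSpace ℝ (Fin d)) (M : Matrix (Fin d) (Fin d) ℝ)
      (x : EuclideanSpace ℝ (Fin d)) := c + Matrix.toEuclideanCLM (𝕜 := ℝ) (CFC.sqrt M) x
  have hf (c M) : Measurable (f c M) := by fun_prop
  have hfg : Measurable fun x => (f a A x, f b B x) := (hf a A).prodMk (hf b B)
  set γ := stdGaussian (EuclideanSpace ℝ (Fin d))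
  have hγ : γ.map (fun x => (f a A x, f b B x)) ∈
      Joint (multivariateGaussian a A) (multivariateGaussian b B) := by
    refine ⟨Measure.isProbabilityMeasure_map hfg.aemeasurable, ?_, ?_⟩
    -- `multivariateGaussian` is by definition the image of the standard Gaussian under `f`.
    · rw [Measure.map_map measurable_fst hfg]; rfl
    · rw [Measure.map_map measurable_snd hfg]; rfl
  obtain ⟨hint, hval⟩ := integral_norm_add_toEuclideanCLM_sq (a - b) (CFC.sqrt A - CFC.sqrt B)
  rw [wasserstein_two_sq, OT]
  refine (iInf₂_le _ hγ).trans ?_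
  rw [lintegral_map (by fun_prop) hfg]
  have hcost (x : EuclideanSpace ℝ (Fin d)) : edist (f a A x) (f b B x) ^ (2 : ℝ) = ENNReal.ofReal
      (‖(a - b) + Matrix.toEuclideanCLM (𝕜 := ℝ) (CFC.sqrt A - CFC.sqrt B) x‖ ^ 2) := by
    have : f a A x - f b B x
        = (a - b) + Matrix.toEuclideanCLM (𝕜 := ℝ) (CFC.sqrt A - CFC.sqrt B) x := by
      simp only [f, map_sub, sub_apply]
      abel
    rw [edist_dist, dist_eq_norm, this, ENNReal.ofReal_rpow_of_nonneg (norm_nonneg _) (by norm_num)]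
    norm_num
  simp only [hcost]
  rw [← ofReal_integral_eq_lintegral_ofReal hint (Filter.Eventually.of_forall fun x => by positivity),
    hval, ← hsNorm_sq]
  exact ENNReal.ofReal_le_ofReal (add_le_add le_rfl (hsNorm_sqrt_sub_sqrt_sq_le hA hB))

/-! ### Empirical covariance and the constant `κ`. -/

/-- The empirical covariance in terms of samples that are centred at any point `μ`. -/
theorem empiricalCov_apply {d m : ℕ} (hm : 0 < m) (x : Fin m → EuclideanSpace ℝ (Fin d))
    (μ : EuclideanSpace ℝ (Fin d)) (j k : Fin d) :
    empiricalCov x j k = (1 / (m : ℝ)) * ∑ i, (x i j - μ j) * (x i k - μ k)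
      - (empiricalMean x - μ) j * (empiricalMean x - μ) k := by
  have hm0 : (m : ℝ) ≠ 0 := by positivity
  have hmean (l : Fin d) : ∑ i, x i l = m * empiricalMean x l := by
    simp [empiricalMean, hm0]
  have h1 : ∑ i, (x i j - empiricalMean x j) * (x i k - empiricalMean x k)
      = ∑ i, ((x i j - μ j) * (x i k - μ k)) - m * ((empiricalMean x j - μ j) *
        (empiricalMean x k - μ k)) := by
    simp only [sub_mul, mul_sub, Finset.sum_sub_distrib, ← Finset.sum_mul, ← Finset.mul_sum, hmean,
      Finset.sum_const, Finset.card_univ, Fintype.card_fin, nsmul_eq_mul]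
    ring
  have h2 : empiricalCov x j k
      = (1 / (m : ℝ)) * ∑ i, (x i j - empiricalMean x j) * (x i k - empiricalMean x k) := by
    simp [empiricalCov, Matrix.sum_apply, Matrix.vecMulVec_apply]
  rw [h2, h1, mul_sub]
  simp only [PiLp.sub_apply]
  field_simp

/-- The second moment matrix of the samples about `μ`. -/
noncomputable def empiricalSecondMoment {d m : ℕ} (μ : EuclideanSpace ℝ (Fin d))
    (x : Fin m → EuclideanSpace ℝ (Fin d)) : Matrix (Fin d) (Fin d) ℝ :=
  Matrix.of fun j k => (1 / (m : ℝ)) * ∑ i, (x i j - μ j) * (x i k - μ k)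

theorem hsNorm_vecMulVec_self {d : ℕ} (y : EuclideanSpace ℝ (Fin d)) :
    hsNorm (Matrix.vecMulVec y.ofLp y.ofLp) = ‖y‖ ^ 2 := by
  refine (sq_eq_sq₀ (hsNorm_nonneg _) (by positivity)).1 ?_
  rw [hsNorm_sq, EuclideanSpace.norm_sq_eq, sq, Finset.sum_mul_sum]
  simp [Matrix.vecMulVec_apply, mul_pow]

/-- Centring at the true mean makes the summands independent; the price is a rank-one term of norm
`‖μ_X - μ‖²`. -/
theorem hsNorm_empiricalCov_sub_le {d m : ℕ} (hm : 0 < m) (x : Fin m → EuclideanSpace ℝ (Fin d))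
    (μ : EuclideanSpace ℝ (Fin d)) (C : Matrix (Fin d) (Fin d) ℝ) :
    hsNorm (empiricalCov x - C)
      ≤ hsNorm (empiricalSecondMoment μ x - C) + ‖empiricalMean x - μ‖ ^ 2 := by
  have : empiricalCov x - C = (empiricalSecondMoment μ x - C)
      - Matrix.vecMulVec (empiricalMean x - μ).ofLp (empiricalMean x - μ).ofLp := by
    ext j k
    simp only [Matrix.sub_apply, empiricalCov_apply hm x μ, empiricalSecondMoment, Matrix.of_apply,
      Matrix.vecMulVec_apply]
    ring
  rw [this, ← hsNorm_vecMulVec_self]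
  exact hsNorm_sub_le _ _

/-- All other terms under the fourth root are nonnegative. -/
theorem trace_le_gaussianKappa_sq {d : ℕ} (μ : EuclideanSpace ℝ (Fin d))
    {C : Matrix (Fin d) (Fin d) ℝ} (hC : C.PosSemidef) : C.trace ≤ gaussianKappa μ C ^ 2 := by
  have hT : 0 ≤ C.trace := hC.trace_nonneg
  have hin : 0 ≤ inner ℝ μ (Matrix.toEuclideanCLM (𝕜 := ℝ) C μ) := by
    rw [Matrix.inner_toEuclideanCLM]
    simpa using hC.dotProduct_mulVec_nonneg μ.ofLp
  have hle : C.trace ^ 2 ≤ 2 * hsNorm C ^ 2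
      + 4 * inner ℝ μ (Matrix.toEuclideanCLM (𝕜 := ℝ) C μ) + (C.trace + ‖μ‖ ^ 2) ^ 2 := by
    nlinarith [sq_nonneg (hsNorm C), sq_nonneg ‖μ‖, mul_nonneg hT (sq_nonneg ‖μ‖)]
  refine (sq_le_sq₀ hT (by positivity)).1 (hle.trans_eq ?_)
  have h0 := (sq_nonneg C.trace).trans hle
  rw [gaussianKappa, ← pow_mul, ← Real.rpow_mul_natCast h0]
  norm_num

theorem gaussianKappa_nonneg {d : ℕ} (μ : EuclideanSpace ℝ (Fin d))
    {C : Matrix (Fin d) (Fin d) ℝ} (hC : C.PosSemidef) : 0 ≤ gaussianKappa μ C := by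
  have hin : 0 ≤ inner ℝ μ (Matrix.toEuclideanCLM (𝕜 := ℝ) C μ) := by
    rw [Matrix.inner_toEuclideanCLM]
    simpa using hC.dotProduct_mulVec_nonneg μ.ofLp
  exact Real.rpow_nonneg (by positivity) _

/-! ### Moments of one sample. -/

section GaussianSample

variable {d : ℕ} {μ : EuclideanSpace ℝ (Fin d)} {C : Matrix (Fin d) (Fin d) ℝ} {Ω : Type*}
  [MeasurableSpace Ω] {P : Measure Ω} {X : Ω → EuclideanSpace ℝ (Fin d)}

theorem hasLaw_centred_eval (hC : C.PosSemidef) (hX : HasLaw X (multivariateGaussian μ C) P)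
    (j : Fin d) : HasLaw (fun ω => X ω j - μ j) (gaussianReal 0 (C j j).toNNReal) P := by
  have h := (measurePreserving_eval_multivariateGaussian (μ := μ) hC (i := j)).fun_comp_hasLaw hX
  have h' : HasLaw (fun x : ℝ => x - μ j) (gaussianReal 0 (C j j).toNNReal)
      (gaussianReal (μ j) (C j j).toNNReal) :=
    ⟨by fun_prop, by rw [gaussianReal_map_sub_const, sub_self]⟩
  exact h'.fun_comp h

theorem memLp_centred_eval (hC : C.PosSemidef) (hX : HasLaw X (multivariateGaussian μ C) P)
    (j : Fin d) {p : ℝ≥0∞} (hp : p ≠ ∞) : MemLp (fun ω => X ω j - μ j) p P := by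
  have h := hasLaw_centred_eval hC hX j
  have := memLp_id_gaussianReal' (μ := 0) (v := (C j j).toNNReal) p hp
  rw [← h.map_eq] at this
  exact (memLp_map_measure_iff (by fun_prop) h.aemeasurable).1 this

theorem integral_centred_eval (hC : C.PosSemidef) (hX : HasLaw X (multivariateGaussian μ C) P)
    (j : Fin d) : ∫ ω, (X ω j - μ j) ∂P = 0 := by
  rw [(hasLaw_centred_eval hC hX j).integral_eq, integral_id_gaussianReal]

theorem integral_centred_eval_pow_two (hC : C.PosSemidef)
    (hX : HasLaw X (multivariateGaussian μ C) P) (j : Fin d) :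
    ∫ ω, (X ω j - μ j) ^ 2 ∂P = C j j := by
  have := (hasLaw_centred_eval hC hX j).integral_comp (f := fun x => x ^ 2) (by fun_prop)
  simp only [Function.comp_def] at this
  rw [this, integral_gaussianReal_zero_pow_two, Real.coe_toNNReal _ hC.diag_nonneg]

theorem integral_centred_eval_pow_four (hC : C.PosSemidef)
    (hX : HasLaw X (multivariateGaussian μ C) P) (j : Fin d) :
    ∫ ω, (X ω j - μ j) ^ 4 ∂P = 3 * C j j ^ 2 := by
  have := (hasLaw_centred_eval hC hX j).integral_comp (f := fun x => x ^ 4) (by fun_prop)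
  simp only [Function.comp_def] at this
  rw [this, integral_gaussianReal_zero_pow_four, Real.coe_toNNReal _ hC.diag_nonneg]

theorem integral_centred_eval_mul (hC : C.PosSemidef)
    (hX : HasLaw X (multivariateGaussian μ C) P) (j k : Fin d) :
    ∫ ω, (X ω j - μ j) * (X ω k - μ k) ∂P = C j k := by
  have h := hX.covariance_fun_comp (f := fun x => x j) (g := fun x => x k)
    (by fun_prop) (by fun_prop)
  rw [covariance_eval_multivariateGaussian hC] at h
  rw [← h, covariance]
  have hmean (l : Fin d) : ∫ ω, X ω l ∂P = μ l := by
    have hl := (measurePreserving_eval_multivariateGaussian (μ := μ) hC (i := l)).fun_comp_hasLaw hX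
    rw [hl.integral_eq, integral_id_gaussianReal]
  simp only [hmean]

theorem memLp_centred_eval_mul (hC : C.PosSemidef)
    (hX : HasLaw X (multivariateGaussian μ C) P) (j k : Fin d) :
    MemLp (fun ω => (X ω j - μ j) * (X ω k - μ k)) 2 P := by
  have : ENNReal.HolderTriple 4 4 2 := by
    refine ⟨?_⟩
    rw [← two_mul, show (4 : ℝ≥0∞) = 2 * 2 by norm_num,
      ENNReal.mul_inv (Or.inl two_ne_zero) (Or.inl ENNReal.ofNat_ne_top), ← mul_assoc,
      ENNReal.mul_inv_cancel two_ne_zero ENNReal.ofNat_ne_top, one_mul]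
  exact (memLp_centred_eval hC hX k (p := 4) ENNReal.ofNat_ne_top).mul
    (memLp_centred_eval hC hX j (p := 4) ENNReal.ofNat_ne_top)

/-- Cauchy–Schwarz reduces this to fourth moments of single coordinates. The product form sums over
`j, k` to `3 (Tr C)²`. -/
theorem integral_centred_eval_mul_sq_le (hC : C.PosSemidef)
    (hX : HasLaw X (multivariateGaussian μ C) P) (j k : Fin d) :
    ∫ ω, ((X ω j - μ j) * (X ω k - μ k)) ^ 2 ∂P ≤ 3 * C j j * C k k := by
  have hLp (l : Fin d) : MemLp (fun ω => (X ω l - μ l) ^ 2) (ENNReal.ofReal 2) P := by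
    simpa [sq] using memLp_centred_eval_mul hC hX l l
  have h := integral_mul_le_Lp_mul_Lq_of_nonneg Real.HolderConjugate.two_two
    (Filter.Eventually.of_forall fun ω => sq_nonneg (X ω j - μ j))
    (Filter.Eventually.of_forall fun ω => sq_nonneg (X ω k - μ k)) (hLp j) (hLp k)
  have hpow (l : Fin d) (ω : Ω) : ((X ω l - μ l) ^ 2) ^ (2 : ℝ) = (X ω l - μ l) ^ 4 := by
    rw [Real.rpow_two, ← pow_mul]
  simp only [hpow, integral_centred_eval_pow_four hC hX, ← Real.sqrt_eq_rpow] at h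
  rw [← Real.sqrt_mul (by positivity)] at h
  simp only [mul_pow]
  refine h.trans_eq ?_
  rw [show 3 * C j j ^ 2 * (3 * C k k ^ 2) = (3 * C j j * C k k) ^ 2 by ring]
  have := hC.diag_nonneg (i := j)
  have := hC.diag_nonneg (i := k)
  exact Real.sqrt_sq (by positivity)

end GaussianSample

/-! ### Concentration of the empirical moments. -/

section GaussianSamples

variable {d m : ℕ} {μ : EuclideanSpace ℝ (Fin d)} {C : Matrix (Fin d) (Fin d) ℝ} {Ω : Type*}
  [MeasurableSpace Ω] {P : Measure Ω} [IsProbabilityMeasure P]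
  {X : Fin m → Ω → EuclideanSpace ℝ (Fin d)}

theorem integral_norm_empiricalMean_sub_sq_le (hm : 0 < m) (hC : C.PosSemidef)
    (hX : ∀ i, HasLaw (X i) (multivariateGaussian μ C) P) (hind : iIndepFun X P) :
    Integrable (fun ω => ‖empiricalMean (fun i => X i ω) - μ‖ ^ 2) P ∧
    ∫ ω, ‖empiricalMean (fun i => X i ω) - μ‖ ^ 2 ∂P ≤ C.trace / m := by
  have hm0 : (m : ℝ) ≠ 0 := by positivity
  have hexp : (fun ω => ‖empiricalMean (fun i => X i ω) - μ‖ ^ 2)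
      = fun ω => ∑ j, ((1 / (m : ℝ)) * ∑ i, (X i ω j - μ j) - 0) ^ 2 := by
    ext ω
    rw [EuclideanSpace.norm_sq_eq]
    refine Finset.sum_congr rfl fun j _ => ?_
    rw [Real.norm_eq_abs, sq_abs]
    congr 1
    simp [empiricalMean, mul_sub, hm0]
  have h (j : Fin d) := integral_average_sub_sq_le hm
    (fun i => memLp_centred_eval hC (hX i) j ENNReal.ofNat_ne_top)
    (hind.comp (fun _ x => x j - μ j) fun _ => by fun_prop)
    (fun i => integral_centred_eval hC (hX i) j)
    (fun i => (integral_centred_eval_pow_two hC (hX i) j).le)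
  rw [hexp]
  refine ⟨integrable_finsetSum _ fun j _ => (h j).1, ?_⟩
  rw [integral_finsetSum _ fun j _ => (h j).1, Matrix.trace, Finset.sum_div]
  exact Finset.sum_le_sum fun j _ => (h j).2

theorem integral_hsNorm_empiricalSecondMoment_sub_sq_le (hm : 0 < m) (hC : C.PosSemidef)
    (hX : ∀ i, HasLaw (X i) (multivariateGaussian μ C) P) (hind : iIndepFun X P) :
    Integrable (fun ω => hsNorm (empiricalSecondMoment μ (fun i => X i ω) - C) ^ 2) P ∧
    ∫ ω, hsNorm (empiricalSecondMoment μ (fun i => X i ω) - C) ^ 2 ∂P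
      ≤ 3 * C.trace ^ 2 / m := by
  have h (j k : Fin d) := integral_average_sub_sq_le hm
    (fun i => memLp_centred_eval_mul hC (hX i) j k)
    (hind.comp (fun _ x => (x j - μ j) * (x k - μ k)) fun _ => by fun_prop)
    (fun i => integral_centred_eval_mul hC (hX i) j k)
    (fun i => integral_centred_eval_mul_sq_le hC (hX i) j k)
  simp only [hsNorm_sq, Matrix.sub_apply, empiricalSecondMoment, Matrix.of_apply]
  have hi (j : Fin d) := integrable_finsetSum Finset.univ fun k _ => (h j k).1
  refine ⟨integrable_finsetSum _ fun j _ => hi j, ?_⟩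
  rw [integral_finsetSum _ fun j _ => hi j]
  calc _ ≤ ∑ j, ∑ k, 3 * C j j * C k k / m := by
        refine Finset.sum_le_sum fun j _ => ?_
        rw [integral_finsetSum _ fun k _ => (h j k).1]
        exact Finset.sum_le_sum fun k _ => (h j k).2
    _ = 3 * C.trace ^ 2 / m := by
        rw [Matrix.trace, sq, Finset.sum_mul_sum]
        simp only [Matrix.diag, Finset.mul_sum, Finset.sum_div, mul_assoc]

/-- With probability at least `1 - δ`, the empirical mean and the empirical second moment matrix
are both close to their expectations. -/
theorem exists_measurableSet_empirical_close (hm : 0 < m) (hC : C.PosSemidef)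
    (hX : ∀ i, HasLaw (X i) (multivariateGaussian μ C) P) (hind : iIndepFun X P)
    {δ : ℝ} (hδ : 0 < δ) :
    ∃ U : Set Ω, MeasurableSet U ∧ ENNReal.ofReal (1 - δ) ≤ P U ∧ ∀ ω ∈ U,
      ‖empiricalMean (fun i => X i ω) - μ‖ ^ 2 ≤ C.trace / m / (δ / 2) ∧
      hsNorm (empiricalSecondMoment μ (fun i => X i ω) - C) ^ 2
        ≤ 3 * C.trace ^ 2 / m / (δ / 2) := by
  obtain ⟨i1, b1⟩ := integral_norm_empiricalMean_sub_sq_le hm hC hX hind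
  obtain ⟨i2, b2⟩ := integral_hsNorm_empiricalSecondMoment_sub_sq_le hm hC hX hind
  have m1 := meas_div_lt_le i1 (fun ω => sq_nonneg _) (half_pos hδ) b1
  have m2 := meas_div_lt_le i2 (fun ω => sq_nonneg _) (half_pos hδ) b2
  set B := {ω | C.trace / m / (δ / 2) < ‖empiricalMean (fun i => X i ω) - μ‖ ^ 2} ∪
    {ω | 3 * C.trace ^ 2 / m / (δ / 2)
      < hsNorm (empiricalSecondMoment μ (fun i => X i ω) - C) ^ 2} with hB
  have hPB : P B ≤ ENNReal.ofReal δ := by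
    refine (measure_union_le _ _).trans ((add_le_add m1 m2).trans_eq ?_)
    rw [← ENNReal.ofReal_add (by positivity) (by positivity), add_halves]
  -- Passing to the measurable hull of the bad event keeps its measure and avoids proving `B`
  -- measurable.
  refine ⟨(toMeasurable P B)ᶜ, (measurableSet_toMeasurable P B).compl, ?_, fun ω hω => ?_⟩
  · rw [prob_compl_eq_one_sub (measurableSet_toMeasurable P B), measure_toMeasurable,
      ENNReal.ofReal_sub _ hδ.le, ENNReal.ofReal_one]
    exact tsub_le_tsub_left hPB 1
  · have hn : ω ∉ B := fun hb => hω (subset_toMeasurable P B hb)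
    exact ⟨not_lt.1 fun h => hn (Or.inl h), not_lt.1 fun h => hn (Or.inr h)⟩

end GaussianSamples

/-! ### Arithmetic of the bounds and conclusion. -/

/-- The deterministic step from the deviations of the two empirical moments to the bound on the
squared distance. -/
theorem sq_add_sqrt_mul_le {d m : ℕ} (hm : 0 < m) {δ T κ a h s : ℝ} (hδ0 : 0 < δ) (hδ1 : δ < 1)
    (hT : 0 ≤ T) (hTκ : T ≤ κ ^ 2) (ha : a ^ 2 ≤ T / m / (δ / 2))
    (hs : s ^ 2 ≤ 3 * T ^ 2 / m / (δ / 2)) (hh : h ≤ s + a ^ 2) :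
    a ^ 2 + √(d : ℝ) * h ≤ 4 * κ ^ 2 / (m * δ ^ 2)
      + 2 * κ ^ 2 * √(d : ℝ) / (√(m : ℝ) * δ) * (3 + 2 / (√(m : ℝ) * δ)) := by
  have hm0 : (0 : ℝ) < m := by exact_mod_cast hm
  have hr : 0 < √(m : ℝ) := Real.sqrt_pos.2 hm0
  have hr2 : √(m : ℝ) ^ 2 = m := Real.sq_sqrt hm0.le
  have ha' : a ^ 2 ≤ 4 * κ ^ 2 / (m * δ ^ 2) := by
    refine ha.trans ?_
    rw [div_div, div_le_div_iff₀ (by positivity) (by positivity)]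
    have h1 : T * δ ^ 2 ≤ κ ^ 2 * δ := by
      have := mul_le_mul_of_nonneg_left hδ1.le hδ0.le
      nlinarith [mul_le_mul hTκ this (by positivity) (by positivity)]
    nlinarith [mul_le_mul_of_nonneg_left h1 hm0.le, mul_nonneg hm0.le (mul_nonneg (sq_nonneg κ) hδ0.le)]
  -- Here `s² ≤ 6 T² / (m δ)`, and `δ < 1` leaves room to bound it by `36 κ⁴ / (m δ²)`.
  have hs' : s ≤ 6 * κ ^ 2 / (√(m : ℝ) * δ) := by
    refine (abs_le_of_sq_le_sq' (hs.trans ?_) (by positivity)).2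
    rw [div_pow, mul_pow √(m : ℝ), hr2, div_div, div_le_div_iff₀ (by positivity) (by positivity)]
    have h2 : T ^ 2 ≤ (κ ^ 2) ^ 2 := pow_le_pow_left₀ hT hTκ 2
    have h1 : T ^ 2 * δ ^ 2 ≤ (κ ^ 2) ^ 2 * δ := by
      have := mul_le_mul_of_nonneg_left hδ1.le hδ0.le
      nlinarith [mul_le_mul h2 this (by positivity) (by positivity)]
    nlinarith [mul_le_mul_of_nonneg_left h1 hm0.le,
      mul_nonneg hm0.le (mul_nonneg (sq_nonneg (κ ^ 2)) hδ0.le)]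
  have hh' : h ≤ 6 * κ ^ 2 / (√(m : ℝ) * δ) + 4 * κ ^ 2 / (m * δ ^ 2) := by linarith
  refine (add_le_add ha' (mul_le_mul_of_nonneg_left hh' (Real.sqrt_nonneg d))).trans_eq ?_
  generalize √(m : ℝ) = r at hr hr2 ⊢
  rw [← hr2]
  field_simp
  ring

/-- For `d = 0` the rate vanishes, while the term `4 κ² / (m δ²)` carries no factor of `d`; so `κ =
0` is needed. -/
theorem gaussianKappa_eq_zero (μ : EuclideanSpace ℝ (Fin 0)) (C : Matrix (Fin 0) (Fin 0) ℝ) :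
    gaussianKappa μ C = 0 := by
  have h1 : hsNorm C = 0 := by
    rw [← sq_eq_zero_iff, hsNorm_sq]; simp
  have h2 : μ = 0 := Subsingleton.elim _ _
  simp [gaussianKappa, h1, h2, Matrix.trace]

/-- For `d, m ≥ 1` both `1 / m` and `√d / m` are at most `√(d / m)`. Adding the coefficients `4/δ²`,
`6/δ`, `4/δ²` gives the square of the constant `K`. -/
theorem bound_le_rate_sq {d m : ℕ} (hm : 0 < m) {δ κ : ℝ} (hδ0 : 0 < δ) (hd : d = 0 → κ = 0) :
    4 * κ ^ 2 / (m * δ ^ 2)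
        + 2 * κ ^ 2 * √(d : ℝ) / (√(m : ℝ) * δ) * (3 + 2 / (√(m : ℝ) * δ))
      ≤ (√(8 / δ ^ 2 + 6 / δ) * κ * ((d : ℝ) / m) ^ ((1 : ℝ) / 4)) ^ 2 := by
  have hm1 : (1 : ℝ) ≤ m := by exact_mod_cast hm
  have hr : 1 ≤ √(m : ℝ) := Real.one_le_sqrt.2 hm1
  have hr0 : 0 < √(m : ℝ) := by linarith
  have hr2 : √(m : ℝ) ^ 2 = m := Real.sq_sqrt (by positivity)
  have hrate : (((d : ℝ) / m) ^ ((1 : ℝ) / 4)) ^ 2 = √(d : ℝ) / √(m : ℝ) := by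
    rw [← Real.rpow_mul_natCast (by positivity), ← Real.sqrt_div (by positivity),
      Real.sqrt_eq_rpow]
    norm_num
  rw [mul_pow, mul_pow, hrate, Real.sq_sqrt (by positivity)]
  rcases Nat.eq_zero_or_pos d with h0 | hpos
  · simp [h0, hd h0]
  have hd1 : 1 ≤ √(d : ℝ) := Real.one_le_sqrt.2 (by exact_mod_cast hpos)
  set r := √(m : ℝ)
  set e := √(d : ℝ)
  rw [← hr2]
  have hinv : 1 / r ^ 2 ≤ 1 / r := by
    rw [div_le_div_iff₀ (by positivity) hr0]; nlinarith
  have hA : 1 / r ^ 2 ≤ e / r :=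
    hinv.trans (div_le_div_of_nonneg_right hd1 hr0.le)
  have hB : e / r ^ 2 ≤ e / r := by
    have := mul_le_mul_of_nonneg_left hinv (zero_le_one.trans hd1)
    rwa [mul_one_div, mul_one_div] at this
  calc 4 * κ ^ 2 / (r ^ 2 * δ ^ 2) + 2 * κ ^ 2 * e / (r * δ) * (3 + 2 / (r * δ))
      = κ ^ 2 * (4 / δ ^ 2 * (1 / r ^ 2) + 6 / δ * (e / r) + 4 / δ ^ 2 * (e / r ^ 2)) := by
        field_simp; ring
    _ ≤ κ ^ 2 * (4 / δ ^ 2 * (e / r) + 6 / δ * (e / r) + 4 / δ ^ 2 * (e / r)) := by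
        gcongr
    _ = (8 / δ ^ 2 + 6 / δ) * κ ^ 2 * (e / r) := by ring

theorem mainTheorem12 (δ : ℝ) (hδ0 : 0 < δ) (hδ1 : δ < 1) :
    ∃ K : ℝ, 0 < K ∧
      ∀ (d m : ℕ), 0 < m →
      ∀ (μ : EuclideanSpace ℝ (Fin d)) (C : Matrix (Fin d) (Fin d) ℝ), C.PosSemidef →
      ∀ (Ω : Type*) [MeasurableSpace Ω] (P : Measure Ω) [IsProbabilityMeasure P]
        (X : Fin m → Ω → EuclideanSpace ℝ (Fin d)),
        (∀ i, HasLaw (X i) (multivariateGaussian μ C) P) → iIndepFun X P →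
        ∃ U : Set Ω, MeasurableSet U ∧ ENNReal.ofReal (1 - δ) ≤ P U ∧ ∀ ω ∈ U,
          wasserstein 2
              (multivariateGaussian (empiricalMean fun i => X i ω) (empiricalCov fun i => X i ω))
              (multivariateGaussian μ C) ^ 2
            ≤ ENNReal.ofReal
              (4 * gaussianKappa μ C ^ 2 / (m * δ ^ 2)
                + 2 * gaussianKappa μ C ^ 2 * √(d : ℝ) / (√(m : ℝ) * δ)
                  * (3 + 2 / (√(m : ℝ) * δ))) ∧
          wasserstein 2
              (multivariateGaussian (empiricalMean fun i => X i ω) (empiricalCov fun i => X i ω))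
              (multivariateGaussian μ C)
            ≤ ENNReal.ofReal (K * gaussianKappa μ C * ((d : ℝ) / m) ^ ((1 : ℝ) / 4)) := by
  refine ⟨√(8 / δ ^ 2 + 6 / δ), by positivity, ?_⟩
  intro d m hm μ C hC Ω _ P _ X hX hind
  obtain ⟨U, hU, hPU, h⟩ := exists_measurableSet_empirical_close hm hC hX hind hδ0
  refine ⟨U, hU, hPU, fun ω hω => ?_⟩
  obtain ⟨h1, h2⟩ := h ω hω
  have hκ := gaussianKappa_nonneg μ hC
  have hW := (wasserstein_two_sq_multivariateGaussian_le (empiricalMean fun i => X i ω) μ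
    (empiricalCov_posSemidef fun i => X i ω) hC).trans (ENNReal.ofReal_le_ofReal
      (sq_add_sqrt_mul_le hm hδ0 hδ1 hC.trace_nonneg (trace_le_gaussianKappa_sq μ hC) h1 h2
        (hsNorm_empiricalCov_sub_le hm (fun i => X i ω) μ C)))
  refine ⟨hW, ?_⟩
  have hrate := hW.trans (ENNReal.ofReal_le_ofReal
    (bound_le_rate_sq hm hδ0 (κ := gaussianKappa μ C) fun h0 => by
      subst h0; exact gaussianKappa_eq_zero μ C))
  rw [ENNReal.ofReal_pow (by positivity)] at hrate
  exact (ENNReal.pow_le_pow_left_iff two_ne_zero).1 hrate
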